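/- **Setting.** Let $V$ be a finite set of nodes with a tree metric $d_T$: there is a tree $T$ on a vertex set $V_T \supseteq V$ with positive edge weights such that $d_T(u,v)$ is the weighted length of the unique simple path from $u$ to $v$ in $T$. Assume that distinct unordered pairs of distinct nodes of $V$ have distinct distances. Write $u \prec (v,w)$ if $d_T(u,v) < d_T(v,w)$ and $d_T(u,w) < d_T(v,w)$. A *configuration* $c$ assigns to each node $v$ a set $N_v \subseteq V\setminus\{v\}$ of references stored in its local memory and a channel, i.e. a finite multiset of messages, each carrying one reference to a node of $V \setminus\{v\}$. The pair $(v,w)$ is an *explicit edge* of $c$ if $w \in N_v$, and an *implicit edge* if a reference to $w$ is in the channel of $v$. $G^*_c$ is the undirected graph on $V$ formed by all explicit and implicit edges. *Protocol BuildMST.* In a step, one node $v$ is activated and an arbitrary (possibly empty) sub-multiset of the messages in its channel is delivered: these messages leave the channel and their references are added to $N_v$. Then $v$ processes, in an arbitrary order, each $w$ that is now in $N_v$: if the current $N_v$ contains some $u \prec (v,w)$, then $v$ sends a message with reference $w$ to one such $u$ (arbitrarily chosen) and removes $w$ from $N_v$; otherwise $v$ sends a message with a reference to itself to $w$. Sending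 a message to a node puts it into that node's channel. A configuration $c'$ that can result from $c$ by one such step is called a *successor* of $c$. A *computation* is an infinite sequence of configurations, each obtained from the preceding one by a step, such that every node is activated infinitely often and every message in a channel is eventually delivered (there is no assumption on the order of delivery). For $S \subseteq V$ nonempty, $MST(S,d_T)$ is the minimum spanning tree of the complete graph on $S$ with edge weights $d_T$. A configuration $c$ is *legal*, $c \in \mathcal{L}_{MST}$, if, with $V_1,\dots,V_k$ the vertex sets of the connected components of $G_c^*$, 1. $(v,w)$ is an explicit edge of $c$ if and only if $\{v,w\} \in MST(V_i,d_T)$ for some $i$, and 2. every implicit edge $(v,w)$ of $c$ satisfies $\{v,w\} \in MST(V_i,d_T)$ for some $i$. **Theorem.** BuildMST is self-stabilizing with respect to $\mathcal{L}_{MST}$, that is: * (Convergence) for every configuration $c_0$, every computation that starts in $c_0$ contains a configuration in $\mathcal{L}_{MST}$; * (Closure) every successor of a configuration in $\mathcal{L}_{MST}$ is in $\mathcal{L}_{MST}$. -/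

import Mathlib

/-! ### Tree metrics -/

/-- The metric of `V` is the tree metric induced by the weighted tree `(T, f)` on `VT ⊇ V`
(the inclusion is `ι`): edge weights are positive, and the distance of two nodes is the weighted
length of the unique simple path of `T` between them. -/
structure IsTreeMetric {V : Type*} [MetricSpace V] {VT : Type*}
    (T : SimpleGraph VT) (f : Sym2 VT → ℝ) (ι : V ↪ VT) : Prop where
  isTree : T.IsTree
  weight_pos : ∀ e ∈ T.edgeSet, 0 < f e
  dist_eq : ∀ (u v : V) (p : T.Walk (ι u) (ι v)), p.IsPath → dist u v = (p.edges.map f).sum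

/-- Different (unordered) pairs of distinct nodes have different distances. -/
def DistinctDistances (V : Type*) [MetricSpace V] : Prop :=
  ∀ u v x y : V, u ≠ v → x ≠ y → dist u v = dist x y → s(u, v) = s(x, y)

/-- `Closer u v w` is the relation `u ≺ (v, w)`: `u` is closer to both `v` and `w` than these are
to each other. -/
def Closer {V : Type*} [MetricSpace V] (u v w : V) : Prop :=
  dist u v < dist v w ∧ dist u w < dist v w

/-! ### Minimum spanning trees of the complete graph on a set of nodes -/

/-- The length of an undirected edge. -/
noncomputable def edgeLength {V : Type*} [MetricSpace V] : Sym2 V → ℝ :=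
  Sym2.lift ⟨fun u v => dist u v, fun u v => dist_comm u v⟩

/-- `M` is a set of edges of the complete graph on `S`, and the graph `(S, M)` is connected. -/
def IsConnectedOn {V : Type*} (S : Set V) (M : Finset (Sym2 V)) : Prop :=
  (∀ e ∈ M, ¬ e.IsDiag ∧ ∀ x ∈ e, x ∈ S) ∧
    ((SimpleGraph.fromEdgeSet (M : Set (Sym2 V))).induce S).Connected

/-- `M` is a minimum spanning tree of the complete graph on `S`: it connects `S` and has minimum
total length among all sets of edges that do so. -/
def IsMST {V : Type*} [MetricSpace V] (S : Set V) (M : Finset (Sym2 V)) : Prop :=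
  IsConnectedOn S M ∧
    ∀ M' : Finset (Sym2 V), IsConnectedOn S M' → ∑ e ∈ M, edgeLength e ≤ ∑ e ∈ M', edgeLength e

/-! ### Configurations -/

/-- A configuration: for each node `v` the set `nbrs v` of references in its local memory, and the
channel `chan v`, an unordered finite collection (with multiplicities) of messages, each carrying
one reference. Nodes hold references to other nodes only. -/
structure Config (V : Type*) where
  nbrs : V → Finset V
  chan : V → Multiset V
  self_notMem_nbrs : ∀ v, v ∉ nbrs v
  self_notMem_chan : ∀ v, v ∉ chan v

namespace Config

/-- The explicit edges: `w` is stored in the local memory of `v`. -/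
def explicitEdges {V : Type*} (c : Config V) : Set (V × V) := {e | e.2 ∈ c.nbrs e.1}

/-- The implicit edges: a reference to `w` is in the channel of `v`. -/
def implicitEdges {V : Type*} (c : Config V) : Set (V × V) := {e | e.2 ∈ c.chan e.1}

/-- The undirected graph of all explicit and implicit edges. -/
def graph {V : Type*} (c : Config V) : SimpleGraph V :=
  SimpleGraph.fromRel fun v w => (v, w) ∈ c.explicitEdges ∪ c.implicitEdges

end Config

/-- The set of legal configurations: with `M K` the minimum spanning tree of (the complete graph on
the nodes of) each connected component `K`, the explicit edges are exactly the edges of these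
trees, in both directions, and all implicit edges belong to these trees. -/
def legalMST (V : Type*) [MetricSpace V] : Set (Config V) :=
  {c | ∃ M : c.graph.ConnectedComponent → Finset (Sym2 V),
    (∀ K, IsMST K.supp (M K)) ∧
    (∀ v w, (v, w) ∈ c.explicitEdges ↔ ∃ K, s(v, w) ∈ M K) ∧
    (∀ v w, (v, w) ∈ c.implicitEdges → ∃ K, s(v, w) ∈ M K)}

/-! ### Protocols, computations, self-stabilization -/

/-- A protocol, given by its steps: `P v D c c'` says that `c'` is a possible successor of `c` when
`v` is activated and the messages `D` from its channel are delivered to it. -/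
abbrev Protocol (V : Type*) := V → Multiset V → Config V → Config V → Prop

/-- `c'` is a succeeding configuration of `c`. -/
def Protocol.Succ {V : Type*} (P : Protocol V) (c c' : Config V) : Prop :=
  ∃ v D, P v D c c'

/-- A computation of `P`: an infinite sequence of configurations, where step `t` activates the node
`act t` and delivers the messages `dlv t` to it. Every node is activated again and again, and
whenever a message with reference `w` is in the channel of `v`, such a message is received by `v`
at that or a later step. (Copies of the same reference in a channel are interchangeable; as this
holds at all times, each of the finitely many copies present is eventually received.) -/
structure Protocol.IsComputation {V : Type*} (P : Protocol V)
    (c : ℕ → Config V) (act : ℕ → V) (dlv : ℕ → Multiset V) : Prop where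
  step : ∀ t, P (act t) (dlv t) (c t) (c (t + 1))
  weaklyFair : ∀ v t, ∃ t' ≥ t, act t' = v
  fairReceipt : ∀ v w t, w ∈ (c t).chan v → ∃ t' ≥ t, act t' = v ∧ w ∈ dlv t'

/-- Self-stabilization with respect to the set `L` of legal configurations. -/
structure Protocol.IsSelfStabilizing {V : Type*} (P : Protocol V) (L : Set (Config V)) : Prop where
  convergence : ∀ c₀ : Config V, ∀ c act dlv, P.IsComputation c act dlv → c 0 = c₀ →
    ∃ t, c t ∈ L
  closure : ∀ c ∈ L, ∀ c', P.Succ c c' → c' ∈ L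

/-! ### The protocol -/

/-- Put a message with a reference to `w` into the channel of `u`. -/
def send {V : Type*} [DecidableEq V] (ch : V → Multiset V) (u w : V) : V → Multiset V :=
  Function.update ch u (w ::ₘ ch u)

/-- `BuildLoop v l N ch N' ch'`: the for-loop of node `v`, run over the nodes in the list `l` in
this order, can turn the local memory `N` of `v` and the channels `ch` into `N'` and `ch'`.
If the current memory holds some `u ≺ (v, w)`, then `w` is delegated to one such `u` and
forgotten; otherwise `v` introduces itself to `w`. -/
inductive BuildLoop {V : Type*} [MetricSpace V] [DecidableEq V] (v : V) :
    List V → Finset V → (V → Multiset V) → Finset V → (V → Multiset V) → Prop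
  | done (N : Finset V) (ch : V → Multiset V) : BuildLoop v [] N ch N ch
  | delegate {w u : V} {l : List V} {N N' : Finset V} {ch ch' : V → Multiset V}
      (hu : u ∈ N) (huw : Closer u v w)
      (rest : BuildLoop v l (N.erase w) (send ch u w) N' ch') :
      BuildLoop v (w :: l) N ch N' ch'
  | introduce {w : V} {l : List V} {N N' : Finset V} {ch ch' : V → Multiset V}
      (hw : ¬ ∃ u ∈ N, Closer u v w)
      (rest : BuildLoop v l N (send ch w v) N' ch') :
      BuildLoop v (w :: l) N ch N' ch'

/-- The protocol BuildMST: the delivered messages `D` leave the channel of the activated node `v`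
and their references are merged into its memory; then `v` runs its loop once over all nodes in its
memory, in an arbitrary order. -/
def buildMST (V : Type*) [MetricSpace V] [DecidableEq V] : Protocol V :=
  fun v D c c' =>
    D ≤ c.chan v ∧
    ∃ (l : List V) (N' : Finset V),
      (l : Multiset V) = (c.nbrs v ∪ D.toFinset).val ∧
      BuildLoop v l (c.nbrs v ∪ D.toFinset) (Function.update c.chan v (c.chan v - D)) N' c'.chan ∧
      c'.nbrs = Function.update c.nbrs v N'

/-!
The proof rests on one property of tree metrics with distinct distances. Call a graph `H` on the
nodes locally minimal if no node `x` has two neighbours `u` and `y` in `H` with `u ≺ (x, y)`. By the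
four-point condition (`IsTreeMetric.fourPoint`), the distance of the ends of a path in such a graph
is at least the length of its first edge and at least the distance left after it
(`LocallyMinimal.dist_le_of_isPath`). Hence a node `v` that is not adjacent to a node `w` of its
component has a neighbour `z ≺ (v, w)` (`LocallyMinimal.adj_or_exists_closer`), and `H` is the
relative neighbourhood graph of its components (`LocallyMinimal.adj_iff`). A minimum spanning tree
is locally minimal by the exchange argument, so it is the relative neighbourhood graph as well
(`IsMST.mem_iff`), which turns legality into a condition on relative neighbourhood edges
(`mem_legalMST_iff`).

Closure: in a legal configuration there is nothing to delegate, and introductions only send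
messages along edges that exist already.

Convergence: delegating `w` from `v` to `u` replaces the edge `{v, w}` by the shorter edges `{v, u}`
and `{u, w}`, so for every `ℓ` the relation of being connected by edges shorter than `ℓ` can only
grow (`ConnBelow.step`). As there are finitely many nodes, all these relations are constant from
some time `t₀` on. An edge whose ends are not connected by shorter ones at `t₀` is then never
delegated; it becomes explicit, and by introduction explicit in both directions
(`eventually_mem_nbrs_of_critical`). These critical edges span the components, and they form a
locally minimal graph, since otherwise one of them would be delegated
(`criticalGraph_locallyMinimal`). So they are the edges wanted, and from then on every node has a
neighbour to which it can delegate any other reference. Other references thus travel along ever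
shorter edges and die out (`eventually_chan_imp`).
-/

/-! ### The four-point condition for tree metrics -/

/-- The total weight of the edges of a walk. -/
def walkWeight {VT : Type*} {T : SimpleGraph VT} (f : Sym2 VT → ℝ) {a b : VT}
    (p : T.Walk a b) : ℝ :=
  (p.edges.map f).sum

lemma walkWeight_append {VT : Type*} {T : SimpleGraph VT} (f : Sym2 VT → ℝ) {a b c : VT}
    (p : T.Walk a b) (q : T.Walk b c) :
    walkWeight f (p.append q) = walkWeight f p + walkWeight f q := by
  simp [walkWeight]

lemma walkWeight_reverse {VT : Type*} {T : SimpleGraph VT} (f : Sym2 VT → ℝ) {a b : VT}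
    (p : T.Walk a b) : walkWeight f p.reverse = walkWeight f p := by
  simp [walkWeight, List.sum_reverse]

lemma walkWeight_bypass_le {VT : Type*} [DecidableEq VT] {T : SimpleGraph VT} {f : Sym2 VT → ℝ}
    (hf : ∀ e ∈ T.edgeSet, 0 < f e) {a b : VT} (p : T.Walk a b) :
    walkWeight f p.bypass ≤ walkWeight f p := by
  refine List.Sublist.sum_le_sum (p.edges_bypass_sublist_edges.map f) ?_
  intro x hx
  obtain ⟨e, he, rfl⟩ := List.mem_map.1 hx
  exact (hf e (p.edges_subset_edgeSet he)).le

/-- A walk that ends in `s` has an initial part, up to shortcuts, that meets `s` only at its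
end. -/
lemma exists_isPath_first_hit {VT : Type*} [DecidableEq VT] {T : SimpleGraph VT} {s : Set VT}
    {a b : VT} (p : T.Walk a b) (hb : b ∈ s) :
    ∃ z ∈ s, ∃ q : T.Walk a z, q.IsPath ∧ ∀ y ∈ q.support, y ∈ s → y = z := by
  suffices h : ∃ z ∈ s, ∃ q : T.Walk a z, ∀ y ∈ q.support, y ∈ s → y = z by
    obtain ⟨z, hz, q, hq⟩ := h
    exact ⟨z, hz, q.bypass, q.bypass_isPath,
      fun y hy => hq y (q.support_bypass_subset_support hy)⟩
  induction p with
  | nil => exact ⟨_, hb, .nil, by simp⟩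
  | @cons a c b h p ih =>
    by_cases ha : a ∈ s
    · exact ⟨a, ha, .nil, by simp⟩
    · obtain ⟨z, hz, q, hq⟩ := ih hb
      refine ⟨z, hz, .cons h q, ?_⟩
      intro y hy hys
      rw [SimpleGraph.Walk.support_cons, List.mem_cons] at hy
      rcases hy with rfl | hy
      · exact absurd hys ha
      · exact hq y hy hys

lemma isPath_append_of_forall_eq {VT : Type*} {T : SimpleGraph VT} {a z b : VT}
    {q : T.Walk a z} {p : T.Walk z b} (hq : q.IsPath) (hp : p.IsPath)
    (h : ∀ y ∈ q.support, y ∈ p.support → y = z) : (q.append p).IsPath := by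
  rw [SimpleGraph.Walk.isPath_def, SimpleGraph.Walk.support_append, List.nodup_append]
  have hp' := hp.support_nodup
  rw [← SimpleGraph.Walk.cons_tail_support, List.nodup_cons] at hp'
  refine ⟨hq.support_nodup, hp'.2, ?_⟩
  rintro y hy y' hy' rfl
  exact hp'.1 (h y hy (List.mem_of_mem_tail hy') ▸ hy')

/-- Any three vertices of a tree have a median: a vertex on all walks between any two of them. -/
lemma SimpleGraph.IsTree.exists_median {VT : Type*} {T : SimpleGraph VT} (hT : T.IsTree)
    (v w x : VT) : ∃ z, (∀ p : T.Walk v w, z ∈ p.support) ∧ (∀ p : T.Walk v x, z ∈ p.support) ∧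
      ∀ p : T.Walk w x, z ∈ p.support := by
  classical
  -- by uniqueness of paths, a vertex on one path is on every walk between its end points
  have key : ∀ {a b z : VT} (q : T.Walk a b), q.IsPath → z ∈ q.support →
      ∀ p : T.Walk a b, z ∈ p.support := by
    intro a b z q hq hz p
    have : p.bypass = q := (hT.existsUnique_path a b).unique p.bypass_isPath hq
    exact p.support_bypass_subset_support (this ▸ hz)
  obtain ⟨P, hP, -⟩ := hT.existsUnique_path v w
  obtain ⟨Q, -, -⟩ := hT.existsUnique_path x v
  obtain ⟨z, hz, q, hq, hqz⟩ :=
    exists_isPath_first_hit (s := {y | y ∈ P.support}) Q P.start_mem_support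
  have hz : z ∈ P.support := hz
  have hw : (q.append (P.dropUntil z hz)).IsPath :=
    isPath_append_of_forall_eq hq (hP.dropUntil hz)
      fun y hy hy' => hqz y hy (P.support_dropUntil_subset_support hz hy')
  have hv : (q.append (P.takeUntil z hz).reverse).IsPath :=
    isPath_append_of_forall_eq hq (hP.takeUntil hz).reverse
      fun y hy hy' => hqz y hy (P.support_takeUntil_subset_support hz (by simpa using hy'))
  refine ⟨z, key P hP hz, fun p => ?_, fun p => ?_⟩
  · have := key (z := z) _ hv (by simp) p.reverse
    simpa using this
  · have := key (z := z) _ hw (by simp) p.reverse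
    simpa using this

/-- The four-point condition: of the three ways to pair up four points, none has a sum of distances
above both others. -/
def FourPoint (V : Type*) [MetricSpace V] : Prop :=
  ∀ v w x y : V, dist v y + dist w x ≤ max (dist v w + dist x y) (dist v x + dist w y)

/-- Tree metrics satisfy the four-point condition. If `z` is the median of `v, w, x`, then `z` lies
on the path from `w` to `y` or on that from `x` to `y`, so that one of the two sums on the right
equals the sum of the weights of the tree paths from all four nodes to `z`; the sum on the left is
at most that. -/
lemma IsTreeMetric.fourPoint {V : Type*} [MetricSpace V] {VT : Type*} {T : SimpleGraph VT}
    {f : Sym2 VT → ℝ} {ι : V ↪ VT} (hV : IsTreeMetric T f ι) : FourPoint V := by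
  classical
  intro v w x y
  have hT := hV.isTree
  obtain ⟨z, hvw, hvx, hwx⟩ := hT.exists_median (ι v) (ι w) (ι x)
  choose P hP using fun a : V => (hT.existsUnique_path (ι a) z).exists
  have hle : ∀ a b : V, dist a b ≤ walkWeight f (P a) + walkWeight f (P b) := by
    intro a b
    have h := walkWeight_bypass_le hV.weight_pos ((P a).append (P b).reverse)
    rw [walkWeight_append, walkWeight_reverse] at h
    exact (hV.dist_eq a b _ (SimpleGraph.Walk.bypass_isPath _)).trans_le h
  have heq : ∀ (a b : V) (p : T.Walk (ι a) (ι b)), p.IsPath → z ∈ p.support →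
      dist a b = walkWeight f (P a) + walkWeight f (P b) := by
    intro a b p hp hz
    have h1 : p.takeUntil z hz = P a := (hT.existsUnique_path _ _).unique (hp.takeUntil hz) (hP a)
    have h2 : (p.dropUntil z hz).reverse = P b :=
      (hT.existsUnique_path _ _).unique (hp.dropUntil hz).reverse (hP b)
    rw [← h1, ← h2, walkWeight_reverse, ← walkWeight_append, p.take_spec hz]
    exact hV.dist_eq a b p hp
  obtain ⟨p, hp, -⟩ := hT.existsUnique_path (ι v) (ι w)
  obtain ⟨q, hq, -⟩ := hT.existsUnique_path (ι v) (ι x)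
  obtain ⟨r, hr, -⟩ := hT.existsUnique_path (ι w) (ι y)
  obtain ⟨s, hs, -⟩ := hT.existsUnique_path (ι x) (ι y)
  have e1 := heq v w p hp (hvw p)
  have e2 := heq v x q hq (hvx q)
  have l1 := hle v y
  have l2 := hle w x
  have hz := hwx (r.append s.reverse)
  rw [SimpleGraph.Walk.mem_support_append_iff, SimpleGraph.Walk.support_reverse,
    List.mem_reverse] at hz
  rcases hz with hz | hz
  · have e3 := heq w y r hr hz
    exact le_max_of_le_right (by linarith)
  · have e3 := heq x y s hs hz
    exact le_max_of_le_left (by linarith)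

/-! ### Locally minimal graphs and the relative neighbourhood graph -/

section RelativeNeighbourhood

variable {V : Type*} [MetricSpace V]

lemma Closer.symm {u v w : V} (h : Closer u v w) : Closer u w v :=
  ⟨dist_comm v w ▸ h.2, dist_comm v w ▸ h.1⟩

lemma Closer.ne_right {u v w : V} (h : Closer u v w) : u ≠ w := by
  rintro rfl
  exact lt_irrefl _ (dist_comm u v ▸ h.1)

/-- In a locally minimal graph, no node `x` has a neighbour `u` to which it could delegate another
neighbour `y`. -/
def LocallyMinimal (H : SimpleGraph V) : Prop :=
  ∀ x y u : V, H.Adj x y → H.Adj x u → ¬ Closer u x y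

/-- The pairs of distinct nodes of the same component of `G` such that no node of that component
is closer to both: the edges of the relative neighbourhood graphs of the components. -/
def IsRNGEdge (G : SimpleGraph V) (v w : V) : Prop :=
  v ≠ w ∧ G.Reachable v w ∧ ∀ u, G.Reachable v u → ¬ Closer u v w

lemma IsRNGEdge.symm {G : SimpleGraph V} {v w : V} (h : IsRNGEdge G v w) : IsRNGEdge G w v :=
  ⟨h.1.symm, h.2.1.symm, fun u hu hc => h.2.2 u (h.2.1.trans hu) hc.symm⟩

/-- The distance of the ends of a path in a locally minimal graph is at least the length of its
first edge and at least the distance that is left after this edge. The four-point condition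
applied to the first three nodes and the end of the path carries the induction. -/
lemma LocallyMinimal.dist_le_of_isPath (h4 : FourPoint V) (hd : DistinctDistances V)
    {H : SimpleGraph V} (hH : LocallyMinimal H) {v z w : V} (h : H.Adj v z) (q : H.Walk z w)
    (hp : (SimpleGraph.Walk.cons h q).IsPath) :
    dist v z ≤ dist v w ∧ dist z w ≤ dist v w := by
  induction q generalizing v with
  | nil => exact ⟨le_rfl, by simp⟩
  | @cons z y w h' q ih =>
    rw [SimpleGraph.Walk.cons_isPath_iff] at hp
    obtain ⟨i1, i2⟩ := ih h' hp.1
    have hvy : v ≠ y := by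
      rintro rfl
      exact hp.2 (by simp)
    have l1 : dist v z ≤ dist v y := by
      by_contra! hlt
      have hzy : dist z y < dist v z := by
        by_contra! hle
        rcases hle.lt_or_eq with hl | he
        · exact hH z y v h' h.symm ⟨dist_comm v z ▸ hl, by linarith⟩
        · have := hd v z z y h.ne h'.ne he
          rcases Sym2.eq_iff.1 this with ⟨h1, -⟩ | ⟨h1, -⟩
          · exact h.ne h1
          · exact hvy h1
      exact hH z v y h.symm h' ⟨by rw [dist_comm y z, dist_comm z v]; exact hzy,
        by rw [dist_comm y v, dist_comm z v]; exact hlt⟩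
    have l2 : dist z y ≤ dist v y := by
      by_contra! hlt
      exact hH z y v h' h.symm ⟨l1.trans_lt hlt, hlt⟩
    have l3 : dist v z ≠ dist v y := by
      intro he
      rcases Sym2.eq_iff.1 (hd v z v y h.ne hvy he) with ⟨-, h1⟩ | ⟨h1, -⟩
      · exact h'.ne h1
      · exact hvy h1
    have l4 := lt_of_le_of_ne l1 l3
    rcases le_max_iff.1 (h4 v z w y) with h5 | h5
    · linarith [dist_comm w y]
    · constructor <;> linarith

/-- Greedy routing: in a locally minimal graph, a node is adjacent to a given other node of its
component or has a neighbour to which it can delegate it. -/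
lemma LocallyMinimal.adj_or_exists_closer (h4 : FourPoint V) (hd : DistinctDistances V)
    {H : SimpleGraph V} (hH : LocallyMinimal H) {v w : V} (hvw : v ≠ w) (hr : H.Reachable v w) :
    H.Adj v w ∨ ∃ z, H.Adj v z ∧ Closer z v w := by
  obtain ⟨p, hp⟩ := hr.exists_isPath
  cases p with
  | nil => exact absurd rfl hvw
  | @cons _ z _ h q =>
    by_cases hzw : z = w
    · exact .inl (hzw ▸ h)
    obtain ⟨l1, l2⟩ := hH.dist_le_of_isPath h4 hd h q hp
    refine .inr ⟨z, h, lt_of_le_of_ne (dist_comm z v ▸ l1) fun he => ?_,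
      lt_of_le_of_ne l2 fun he => ?_⟩
    · rcases Sym2.eq_iff.1 (hd z v v w h.ne.symm hvw he) with ⟨h1, -⟩ | ⟨h1, -⟩
      · exact h.ne h1.symm
      · exact hzw h1
    · rcases Sym2.eq_iff.1 (hd z w v w hzw hvw he) with ⟨h1, -⟩ | ⟨h1, -⟩
      · exact h.ne h1.symm
      · exact hzw h1

/-- The edges of a locally minimal graph are determined by its components. -/
lemma LocallyMinimal.adj_iff (h4 : FourPoint V) (hd : DistinctDistances V)
    {H : SimpleGraph V} (hH : LocallyMinimal H) {v w : V} : H.Adj v w ↔ IsRNGEdge H v w := by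
  classical
  refine ⟨fun h => ⟨h.ne, h.reachable, fun u hu hc => ?_⟩, fun h => ?_⟩
  · -- a path from one end of the edge to `u` that avoids the other end is extended by the edge
    have key : ∀ {a b : V}, H.Adj a b → Closer u a b → ∀ p : H.Walk b u, p.IsPath →
        a ∈ p.support := by
      intro a b hab hcl p hp
      by_contra ha
      have := (hH.dist_le_of_isPath h4 hd hab p (hp.cons ha)).1
      have := hcl.1
      rw [dist_comm] at this
      linarith
    obtain ⟨p, hp⟩ := hu.exists_isPath
    have hw := key h.symm hc.symm p hp
    have hv := key h hc (p.dropUntil w hw) (hp.dropUntil hw)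
    -- the part of the path behind `w` returns to its start `v`, so it starts at `v = w`
    have : v = w := by
      by_contra hne
      have h1 := hp.support_nodup
      rw [← p.take_spec hw, SimpleGraph.Walk.support_append, List.nodup_append] at h1
      refine h1.2.2 v (SimpleGraph.Walk.start_mem_support _) v ?_ rfl
      rw [← SimpleGraph.Walk.cons_tail_support, List.mem_cons] at hv
      exact hv.resolve_left hne
    exact h.ne this
  · rcases hH.adj_or_exists_closer h4 hd h.1 h.2.1 with h1 | ⟨z, hz, hc⟩
    · exact h1
    · exact absurd hc (h.2.2 z hz.reachable)

end RelativeNeighbourhood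

/-! ### Minimum spanning trees -/

lemma SimpleGraph.Reachable.of_forall_adj {V : Type*} {G H : SimpleGraph V} {a b : V}
    (hab : G.Reachable a b) (h : ∀ x y, G.Adj x y → H.Reachable x y) : H.Reachable a b := by
  obtain ⟨p⟩ := hab
  induction p with
  | nil => exact .refl _
  | cons hxy _ ih => exact (h _ _ hxy).trans ih

section MST

variable {V : Type*}

lemma isConnectedOn_iff {S : Set V} {M : Finset (Sym2 V)} :
    IsConnectedOn S M ↔ (∀ e ∈ M, ¬ e.IsDiag ∧ ∀ x ∈ e, x ∈ S) ∧ S.Nonempty ∧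
      ∀ a ∈ S, ∀ b ∈ S, (SimpleGraph.fromEdgeSet (M : Set (Sym2 V))).Reachable a b := by
  refine and_congr_right fun hM => ⟨fun h => ⟨?_, fun a ha b hb => ?_⟩, fun h => ?_⟩
  · obtain ⟨a⟩ := h.nonempty
    exact ⟨a, a.2⟩
  · exact (h.preconnected ⟨a, ha⟩ ⟨b, hb⟩).map (SimpleGraph.Embedding.induce S).toHom
  · have key : ∀ {a b : V} (_ : (SimpleGraph.fromEdgeSet (M : Set (Sym2 V))).Walk a b)
        (ha : a ∈ S), ∃ hb : b ∈ S,
          ((SimpleGraph.fromEdgeSet (M : Set (Sym2 V))).induce S).Reachable ⟨a, ha⟩ ⟨b, hb⟩ := by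
      intro a b p
      induction p with
      | nil => exact fun ha => ⟨ha, .refl _⟩
      | @cons a c b hac p ih =>
        intro ha
        have hc : c ∈ S :=
          (hM s(a, c) (by simpa using ((SimpleGraph.fromEdgeSet_adj _).1 hac).1)).2 c (by simp)
        obtain ⟨hb, hr⟩ := ih hc
        refine ⟨hb, SimpleGraph.Reachable.trans (SimpleGraph.Adj.reachable ?_) hr⟩
        simpa using hac
    have : Nonempty S := h.1.to_subtype
    refine ⟨fun a b => ?_⟩
    obtain ⟨p⟩ := h.2 a a.2 b b.2
    exact (key p a.2).2

lemma IsConnectedOn.reachable {S : Set V} {M : Finset (Sym2 V)} (h : IsConnectedOn S M) {a b : V}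
    (ha : a ∈ S) (hb : b ∈ S) : (SimpleGraph.fromEdgeSet (M : Set (Sym2 V))).Reachable a b :=
  (isConnectedOn_iff.1 h).2.2 a ha b hb

variable [MetricSpace V]

/-- The exchange argument: if `v` stays connected to `u` without the edge `{v, w}` of a minimum
spanning tree, then replacing this edge by `{u, w}` cannot make the tree shorter. -/
lemma IsMST.dist_le_of_reachable [DecidableEq V] {S : Set V} {M : Finset (Sym2 V)}
    (hM : IsMST S M) {u v w : V} (hvw : s(v, w) ∈ M) (hu : u ∈ S) (huw : u ≠ w)
    (hr : (SimpleGraph.fromEdgeSet (M.erase s(v, w) : Set (Sym2 V))).Reachable v u) :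
    dist v w ≤ dist u w := by
  by_contra! hlt
  obtain ⟨hE, hS, hC⟩ := isConnectedOn_iff.1 hM.1
  have hw : w ∈ S := (hE _ hvw).2 w (by simp)
  have hM' : IsConnectedOn S (insert s(u, w) (M.erase s(v, w))) := by
    refine isConnectedOn_iff.2 ⟨fun e he => ?_, hS, fun a ha b hb =>
      (hC a ha b hb).of_forall_adj fun x y hxy => ?_⟩
    · rcases Finset.mem_insert.1 he with rfl | he
      · refine ⟨by simpa using huw, fun x hx => ?_⟩
        rcases Sym2.mem_iff.1 hx with rfl | rfl <;> assumption
      · exact hE e (Finset.mem_of_mem_erase he)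
    · have hvw' : (SimpleGraph.fromEdgeSet
          ((insert s(u, w) (M.erase s(v, w)) : Finset (Sym2 V)) : Set (Sym2 V))).Reachable v w := by
        refine (hr.mono (SimpleGraph.fromEdgeSet_mono
          (Finset.coe_subset.2 (Finset.subset_insert _ _)))).trans
          (SimpleGraph.Adj.reachable ?_)
        simp [huw]
      rw [SimpleGraph.fromEdgeSet_adj] at hxy
      by_cases he : s(x, y) = s(v, w)
      · rcases Sym2.eq_iff.1 he with ⟨rfl, rfl⟩ | ⟨rfl, rfl⟩
        · exact hvw'
        · exact hvw'.symm
      · refine SimpleGraph.Adj.reachable ((SimpleGraph.fromEdgeSet_adj _).2 ⟨?_, hxy.2⟩)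
        simpa [he] using Or.inr hxy.1
  have h1 := hM.2 _ hM'
  have h2 : ∑ e ∈ insert s(u, w) (M.erase s(v, w)), edgeLength e
      ≤ dist u w + ∑ e ∈ M.erase s(v, w), edgeLength e := by
    by_cases hmem : s(u, w) ∈ M.erase s(v, w)
    · rw [Finset.insert_eq_of_mem hmem]
      exact le_add_of_nonneg_left dist_nonneg
    · rw [Finset.sum_insert hmem]
      exact le_rfl
  have h3 : dist v w + ∑ e ∈ M.erase s(v, w), edgeLength e = ∑ e ∈ M, edgeLength e :=
    Finset.add_sum_erase M edgeLength hvw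
  linarith

lemma IsMST.not_closer {S : Set V} {M : Finset (Sym2 V)} (hM : IsMST S M) {u v w : V}
    (hvw : s(v, w) ∈ M) (hu : u ∈ S) : ¬ Closer u v w := by
  classical
  intro hc
  have hv : v ∈ S := ((isConnectedOn_iff.1 hM.1).1 _ hvw).2 v (by simp)
  -- without the edge, every node is still connected to one of its ends
  have key : ∀ {a : V}, (SimpleGraph.fromEdgeSet (M : Set (Sym2 V))).Walk a u →
      ∃ x, (x = a ∨ x = v ∨ x = w) ∧
      (SimpleGraph.fromEdgeSet (M.erase s(v, w) : Set (Sym2 V))).Reachable x u := by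
    intro a p
    induction p with
    | nil => exact ⟨_, .inl rfl, .refl _⟩
    | @cons a b _ hab p ih =>
      obtain ⟨x, hx, hr⟩ := ih hu hc
      rcases hx with rfl | hx
      · rw [SimpleGraph.fromEdgeSet_adj] at hab
        by_cases he : s(a, x) = s(v, w)
        · refine ⟨x, .inr ?_, hr⟩
          rcases Sym2.eq_iff.1 he with ⟨-, h⟩ | ⟨-, h⟩
          · exact .inr h
          · exact .inl h
        · refine ⟨a, .inl rfl, SimpleGraph.Reachable.trans (SimpleGraph.Adj.reachable
            ((SimpleGraph.fromEdgeSet_adj _).2 ⟨?_, hab.2⟩)) hr⟩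
          simpa [he] using hab.1
      · exact ⟨x, .inr hx, hr⟩
  obtain ⟨p⟩ := hM.1.reachable hv hu
  obtain ⟨x, hx, hr⟩ := key p
  have hx' : x = v ∨ x = w := by tauto
  rcases hx' with rfl | rfl
  · exact absurd hc.2 (not_lt.2 (hM.dist_le_of_reachable hvw hu hc.ne_right hr))
  · rw [Sym2.eq_swap] at hvw hr
    exact absurd hc.symm.2 (not_lt.2 (hM.dist_le_of_reachable hvw hu hc.symm.ne_right hr))

/-- The minimum spanning tree of `S` is the relative neighbourhood graph of `S`. -/
lemma IsMST.mem_iff (h4 : FourPoint V) (hd : DistinctDistances V) {S : Set V}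
    {M : Finset (Sym2 V)} (hM : IsMST S M) {v w : V} :
    s(v, w) ∈ M ↔ v ≠ w ∧ v ∈ S ∧ w ∈ S ∧ ∀ u ∈ S, ¬ Closer u v w := by
  have hE := (isConnectedOn_iff.1 hM.1).1
  refine ⟨fun h => ⟨by simpa using (hE _ h).1, (hE _ h).2 v (by simp), (hE _ h).2 w (by simp),
    fun u hu => hM.not_closer h hu⟩, fun ⟨hvw, hv, hw, hu⟩ => ?_⟩
  have hloc : LocallyMinimal (SimpleGraph.fromEdgeSet (M : Set (Sym2 V))) := by
    intro x y u hxy hxu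
    rw [SimpleGraph.fromEdgeSet_adj] at hxy hxu
    exact hM.not_closer hxy.1 ((hE _ hxu.1).2 u (by simp))
  rcases hloc.adj_or_exists_closer h4 hd hvw (hM.1.reachable hv hw) with h | ⟨z, hz, hc⟩
  · exact ((SimpleGraph.fromEdgeSet_adj _).1 h).1
  · exact absurd hc (hu z ((hE _ ((SimpleGraph.fromEdgeSet_adj _).1 hz).1).2 z (by simp)))

lemma exists_isMST [Finite V] {S : Set V} (hS : S.Nonempty) : ∃ M, IsMST S M := by
  classical
  have := Fintype.ofFinite V
  have hc : IsConnectedOn S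
      (Finset.univ.filter fun e : Sym2 V => ¬ e.IsDiag ∧ ∀ x ∈ e, x ∈ S) := by
    refine isConnectedOn_iff.2 ⟨fun e he => by simpa using he, hS, fun a ha b hb => ?_⟩
    by_cases hab : a = b
    · exact hab ▸ .refl _
    · refine SimpleGraph.Adj.reachable ((SimpleGraph.fromEdgeSet_adj _).2 ⟨?_, hab⟩)
      simp [hab, ha, hb]
  obtain ⟨M, hM, hmin⟩ := Set.exists_min_image {M : Finset (Sym2 V) | IsConnectedOn S M}
    (fun M => ∑ e ∈ M, edgeLength e) (Set.toFinite _) ⟨_, hc⟩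
  exact ⟨M, hM, hmin⟩

/-! ### Legal configurations -/

lemma Config.graph_adj {V : Type*} {c : Config V} {v w : V} :
    c.graph.Adj v w ↔ v ≠ w ∧ ((w ∈ c.nbrs v ∨ w ∈ c.chan v) ∨ (v ∈ c.nbrs w ∨ v ∈ c.chan w)) :=
  Iff.rfl

/-- A configuration is legal if and only if its explicit edges are exactly the edges of the
relative neighbourhood graphs of its components, and its implicit edges are such edges too. -/
lemma mem_legalMST_iff [Finite V] (h4 : FourPoint V) (hd : DistinctDistances V) {c : Config V} :
    c ∈ legalMST V ↔ (∀ v w, w ∈ c.nbrs v ↔ IsRNGEdge c.graph v w) ∧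
      ∀ v w, w ∈ c.chan v → IsRNGEdge c.graph v w := by
  have key : ∀ M : c.graph.ConnectedComponent → Finset (Sym2 V), (∀ K, IsMST K.supp (M K)) →
      ∀ v w, (∃ K, s(v, w) ∈ M K) ↔ IsRNGEdge c.graph v w := by
    intro M hM v w
    refine ⟨fun ⟨K, hK⟩ => ?_, fun h => ⟨c.graph.connectedComponentMk v, ?_⟩⟩
    · obtain ⟨hvw, hv, hw, hu⟩ := ((hM K).mem_iff h4 hd).1 hK
      rw [SimpleGraph.ConnectedComponent.mem_supp_iff] at hv hw
      subst hv
      refine ⟨hvw, (SimpleGraph.ConnectedComponent.exact hw).symm, fun u hr => hu u ?_⟩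
      exact SimpleGraph.ConnectedComponent.sound hr.symm
    · refine ((hM _).mem_iff h4 hd).2 ⟨h.1, rfl,
        SimpleGraph.ConnectedComponent.sound h.2.1.symm, fun u hu => h.2.2 u ?_⟩
      exact (SimpleGraph.ConnectedComponent.exact hu).symm
  constructor
  · rintro ⟨M, hM, h1, h2⟩
    exact ⟨fun v w => (h1 v w).trans (key M hM v w), fun v w h => (key M hM v w).1 (h2 v w h)⟩
  · rintro ⟨h1, h2⟩
    choose M hM using fun K : c.graph.ConnectedComponent => exists_isMST K.nonempty_supp
    exact ⟨M, hM, fun v w => (h1 v w).trans (key M hM v w).symm,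
      fun v w h => (key M hM v w).2 (h2 v w h)⟩

end MST

/-! ### The steps of the protocol -/

section Steps

variable {V : Type*}

lemma mem_send [DecidableEq V] {ch : V → Multiset V} {u w a b : V} :
    b ∈ send ch u w a ↔ (a = u ∧ b = w) ∨ b ∈ ch a := by
  unfold send
  by_cases h : a = u
  · subst h; simp
  · simp [h]

lemma count_send [DecidableEq V] {ch : V → Multiset V} {u w a b : V} :
    (send ch u w a).count b = (ch a).count b + if a = u ∧ b = w then 1 else 0 := by
  unfold send
  by_cases h : a = u
  · subst h; simp [Multiset.count_cons]
  · simp [h]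

variable [MetricSpace V]

/-- The nodes `a` and `b` are connected by edges of `c` that are shorter than `ℓ`. -/
def ConnBelow (c : Config V) (ℓ : ℝ) (a b : V) : Prop :=
  (SimpleGraph.fromRel fun x y => (y ∈ c.nbrs x ∨ y ∈ c.chan x) ∧ dist x y < ℓ).Reachable a b

lemma ConnBelow.mono {c : Config V} {ℓ ℓ' : ℝ} (h : ℓ ≤ ℓ') {a b : V} (hab : ConnBelow c ℓ a b) :
    ConnBelow c ℓ' a b := by
  refine SimpleGraph.Reachable.mono (fun x y hxy => ?_) hab
  rw [SimpleGraph.fromRel_adj] at hxy ⊢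
  exact ⟨hxy.1, hxy.2.imp (fun h' => ⟨h'.1, h'.2.trans_le h⟩) fun h' => ⟨h'.1, h'.2.trans_le h⟩⟩

lemma ConnBelow.reachable {c : Config V} {ℓ : ℝ} {a b : V} (hab : ConnBelow c ℓ a b) :
    c.graph.Reachable a b := by
  refine SimpleGraph.Reachable.mono (fun x y hxy => ?_) hab
  rw [SimpleGraph.fromRel_adj] at hxy
  exact ⟨hxy.1, hxy.2.imp And.left And.left⟩

lemma connBelow_of_mem {c : Config V} {ℓ : ℝ} {a b : V} (h : b ∈ c.nbrs a ∨ b ∈ c.chan a)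
    (hl : dist a b < ℓ) : ConnBelow c ℓ a b := by
  by_cases hab : a = b
  · exact hab ▸ .refl _
  · exact SimpleGraph.Adj.reachable ((SimpleGraph.fromRel_adj _ _ _).2 ⟨hab, .inl ⟨h, hl⟩⟩)

variable [DecidableEq V]

lemma BuildLoop.mem_chan {v : V} {l : List V} {N N' : Finset V} {ch ch' : V → Multiset V}
    (h : BuildLoop v l N ch N' ch') {a b : V} (hb : b ∈ ch a) : b ∈ ch' a := by
  induction h with
  | done => exact hb
  | delegate _ _ _ ih => exact ih (mem_send.2 (.inr hb))
  | introduce _ _ ih => exact ih (mem_send.2 (.inr hb))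

/-- A reference that is in the memory of the active node during its loop is kept, and this node
introduces itself there, or it is delegated; then the two shorter edges that take its place are
kept or are replaced in the same manner, so that shorter edges connect its ends in the end. -/
lemma BuildLoop.mem_or_connBelow {v : V} {l : List V} {N : Finset V} {ch : V → Multiset V}
    {c' : Config V} (h : BuildLoop v l N ch (c'.nbrs v) c'.chan) {b : V} (hb : b ∈ N) :
    (b ∈ c'.nbrs v ∧ (b ∈ l → v ∈ c'.chan b)) ∨ ConnBelow c' (dist v b) v b := by
  generalize hN : c'.nbrs v = N' at h
  generalize hc : c'.chan = ch' at h
  induction h generalizing b with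
  | done N ch => exact .inl ⟨hb, by simp⟩
  | @delegate w u l N N' ch ch' hu huw rest ih =>
    subst hN hc
    by_cases hbw : b = w
    · subst hbw
      have huN : u ∈ N.erase b := Finset.mem_erase.2 ⟨huw.ne_right, hu⟩
      right
      have h1 : ConnBelow c' (dist v b) v u := by
        rcases ih huN rfl rfl with h | h
        · exact connBelow_of_mem (.inl h.1) (dist_comm u v ▸ huw.1)
        · exact h.mono (dist_comm u v ▸ huw.1.le)
      exact SimpleGraph.Reachable.trans h1
        (connBelow_of_mem (.inr (rest.mem_chan (mem_send.2 (.inl ⟨rfl, rfl⟩)))) huw.2)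
    · exact (ih (Finset.mem_erase.2 ⟨hbw, hb⟩) rfl rfl).imp_left
        fun h => ⟨h.1, fun hl => h.2 ((List.mem_cons.1 hl).resolve_left hbw)⟩
  | @introduce w l N N' ch ch' hw rest ih =>
    subst hN hc
    refine (ih hb rfl rfl).imp_left fun h => ⟨h.1, fun hl => ?_⟩
    rcases List.mem_cons.1 hl with rfl | hl
    · exact rest.mem_chan (mem_send.2 (.inl ⟨rfl, rfl⟩))
    · exact h.2 hl

/-- The active node processes all references in its memory and among the delivered messages. -/
lemma buildMST_mem_or_connBelow {v : V} {D : Multiset V} {c c' : Config V}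
    (h : buildMST V v D c c') {b : V} (hb : b ∈ c.nbrs v ∨ b ∈ D) :
    (b ∈ c'.nbrs v ∧ v ∈ c'.chan b) ∨ ConnBelow c' (dist v b) v b := by
  obtain ⟨-, l, N', hl, hloop, hN'⟩ := h
  obtain rfl : N' = c'.nbrs v := by simp [hN']
  have hbN : b ∈ c.nbrs v ∪ D.toFinset := by simpa using hb
  refine (hloop.mem_or_connBelow hbN).imp_left fun h => ⟨h.1, h.2 ?_⟩
  rw [← Multiset.mem_coe, hl]
  exact hbN

lemma buildMST_nbrs_of_ne {v : V} {D : Multiset V} {c c' : Config V}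
    (h : buildMST V v D c c') {a : V} (ha : a ≠ v) : c'.nbrs a = c.nbrs a := by
  obtain ⟨-, l, N', -, -, hN'⟩ := h
  simp [hN', ha]

lemma buildMST_mem_nbrs_or_connBelow {v : V} {D : Multiset V} {c c' : Config V}
    (h : buildMST V v D c c') {a b : V} (hb : b ∈ c.nbrs a) :
    b ∈ c'.nbrs a ∨ ConnBelow c' (dist a b) a b := by
  by_cases ha : a = v
  · subst ha
    exact (buildMST_mem_or_connBelow h (.inl hb)).imp_left And.left
  · exact .inl (buildMST_nbrs_of_ne h ha ▸ hb)

lemma buildMST_edge_or_connBelow {v : V} {D : Multiset V} {c c' : Config V}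
    (h : buildMST V v D c c') {a b : V} (hb : b ∈ c.nbrs a ∨ b ∈ c.chan a) :
    (b ∈ c'.nbrs a ∨ b ∈ c'.chan a) ∨ ConnBelow c' (dist a b) a b := by
  rcases hb with hb | hb
  · exact (buildMST_mem_nbrs_or_connBelow h hb).imp_left .inl
  · by_cases hd : a = v ∧ b ∈ D
    · obtain ⟨rfl, hd⟩ := hd
      exact (buildMST_mem_or_connBelow h (.inr hd)).imp_left fun h => .inl h.1
    · obtain ⟨-, l, N', -, hloop, -⟩ := h
      refine .inl (.inr (hloop.mem_chan ?_))
      by_cases ha : a = v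
      · subst ha
        rw [Function.update_self, ← Multiset.count_pos, Multiset.count_sub,
          Multiset.count_eq_zero.2 fun hD => hd ⟨rfl, hD⟩]
        exact Multiset.count_pos.2 hb
      · rwa [Function.update_of_ne ha]

lemma BuildLoop.subset {v : V} {l : List V} {N N' : Finset V} {ch ch' : V → Multiset V}
    (h : BuildLoop v l N ch N' ch') : N' ⊆ N := by
  induction h with
  | done => exact subset_rfl
  | delegate _ _ _ ih => exact ih.trans (Finset.erase_subset _ _)
  | introduce _ _ ih => exact ih

lemma BuildLoop.not_closer {v : V} {l : List V} {N N' : Finset V} {ch ch' : V → Multiset V}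
    (h : BuildLoop v l N ch N' ch') {b u : V} (hbl : b ∈ l) (hb : b ∈ N') (hu : u ∈ N') :
    ¬ Closer u v b := by
  induction h with
  | done => simp at hbl
  | @delegate w u l N N' ch ch' hu' huw rest ih =>
    have hbw : b ≠ w := Finset.ne_of_mem_erase (rest.subset hb)
    exact ih ((List.mem_cons.1 hbl).resolve_left hbw) hb hu
  | @introduce w l N N' ch ch' hw rest ih =>
    rcases List.mem_cons.1 hbl with rfl | hbl
    · exact fun hc => hw ⟨u, rest.subset hu, hc⟩
    · exact ih hbl hb hu

/-- No two references left in the memory of a node after its activation allow a delegation. -/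
lemma buildMST_not_closer {v : V} {D : Multiset V} {c c' : Config V} (h : buildMST V v D c c')
    {b u : V} (hb : b ∈ c'.nbrs v) (hu : u ∈ c'.nbrs v) : ¬ Closer u v b := by
  obtain ⟨-, l, N', hl, hloop, hN'⟩ := h
  obtain rfl : N' = c'.nbrs v := by simp [hN']
  refine hloop.not_closer ?_ hb hu
  rw [← Multiset.mem_coe, hl]
  exact hloop.subset hb

/-- Bottleneck distances never grow. -/
lemma ConnBelow.step {v : V} {D : Multiset V} {c c' : Config V} (h : buildMST V v D c c')
    {ℓ : ℝ} {a b : V} (hab : ConnBelow c ℓ a b) : ConnBelow c' ℓ a b := by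
  have key : ∀ x y, (y ∈ c.nbrs x ∨ y ∈ c.chan x) ∧ dist x y < ℓ → ConnBelow c' ℓ x y := by
    rintro x y ⟨h1, h2⟩
    rcases buildMST_edge_or_connBelow h h1 with h3 | h3
    · exact connBelow_of_mem h3 h2
    · exact h3.mono h2.le
  refine SimpleGraph.Reachable.of_forall_adj hab fun x y hxy => ?_
  rcases ((SimpleGraph.fromRel_adj _ _ _).1 hxy).2 with h1 | h1
  · exact key x y h1
  · exact SimpleGraph.Reachable.symm (key y x h1)

lemma buildMST_reachable {v : V} {D : Multiset V} {c c' : Config V} (h : buildMST V v D c c')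
    {a b : V} (hab : c.graph.Reachable a b) : c'.graph.Reachable a b := by
  have key : ∀ x y, (y ∈ c.nbrs x ∨ y ∈ c.chan x) → c'.graph.Reachable x y := by
    intro x y h1
    rcases buildMST_edge_or_connBelow h h1 with h3 | h3
    · exact (connBelow_of_mem h3 (lt_add_one _)).reachable
    · exact h3.reachable
  refine SimpleGraph.Reachable.of_forall_adj hab fun x y hxy => ?_
  rcases (Config.graph_adj.1 hxy).2 with h1 | h1
  · exact key x y h1
  · exact (key y x h1).symm

/-- The loop of a node `v` whose memory holds all its neighbours in the locally minimal graph `H`,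
and otherwise only nodes of the same component of `H`: the neighbours in `H` are introduced, and
all other nodes are delegated along edges shorter than their distance to `v`. -/
lemma BuildLoop.of_locallyMinimal (h4 : FourPoint V) (hd : DistinctDistances V)
    {H : SimpleGraph V} (hH : LocallyMinimal H) {v : V} {l : List V} {N N' : Finset V}
    {ch ch' : V → Multiset V} (h : BuildLoop v l N ch N' ch')
    (hN : ∀ u ∈ N, v ≠ u ∧ H.Reachable v u) (hl : ∀ u ∈ l, v ≠ u ∧ H.Reachable v u)
    (hHN : ∀ u, H.Adj v u → u ∈ N) :
    (∀ u, H.Adj v u → u ∈ N') ∧ (∀ u ∈ N', u ∈ N ∧ (u ∈ l → H.Adj v u)) ∧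
      ∀ a b, ¬ H.Adj a b → (ch' a).count b ≤ (ch a).count b ∨
        (b ∈ l ∧ ¬ H.Adj v b ∧ dist a b < dist v b) := by
  induction h with
  | done N ch => exact ⟨hHN, fun u hu => ⟨hu, by simp⟩, fun a b _ => .inl le_rfl⟩
  | @delegate w u l N N' ch ch' hu huw rest ih =>
    have hw : ¬ H.Adj v w := fun hvw =>
      ((hH.adj_iff h4 hd).1 hvw).2.2 u (hN u hu).2 huw
    obtain ⟨i1, i2, i3⟩ := ih (fun u hu => hN u (Finset.mem_of_mem_erase hu))
      (fun u hu => hl u (List.mem_cons_of_mem _ hu))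
      (fun u hu => Finset.mem_erase.2 ⟨fun e => hw (e ▸ hu), hHN u hu⟩)
    refine ⟨i1, fun x hx => ?_, fun a b hab => ?_⟩
    · obtain ⟨h1, h2⟩ := i2 x hx
      rw [Finset.mem_erase] at h1
      exact ⟨h1.2, fun hxl => h2 ((List.mem_cons.1 hxl).resolve_left h1.1)⟩
    · by_cases he : a = u ∧ b = w
      · obtain ⟨rfl, rfl⟩ := he
        exact .inr ⟨by simp, hw, huw.2⟩
      · rcases i3 a b hab with h1 | h1
        · rw [count_send, if_neg he] at h1
          exact .inl h1
        · exact .inr ⟨List.mem_cons_of_mem _ h1.1, h1.2⟩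
  | @introduce w l N N' ch ch' hw rest ih =>
    have hvw : H.Adj v w := by
      obtain ⟨h1, h2⟩ := hl w (by simp)
      rcases hH.adj_or_exists_closer h4 hd h1 h2 with h3 | ⟨z, hz, hc⟩
      · exact h3
      · exact absurd ⟨z, hHN z hz, hc⟩ hw
    obtain ⟨i1, i2, i3⟩ := ih hN (fun u hu => hl u (List.mem_cons_of_mem _ hu)) hHN
    refine ⟨i1, fun x hx => ⟨(i2 x hx).1, fun hxl => ?_⟩, fun a b hab => ?_⟩
    · rcases List.mem_cons.1 hxl with rfl | hxl
      · exact hvw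
      · exact (i2 x hx).2 hxl
    · have he : ¬ (a = w ∧ b = v) := by
        rintro ⟨rfl, rfl⟩
        exact hab hvw.symm
      rcases i3 a b hab with h1 | h1
      · rw [count_send, if_neg he] at h1
        exact .inl h1
      · exact .inr ⟨List.mem_cons_of_mem _ h1.1, h1.2⟩

/-- The same for a whole step: afterwards the memory of the active node consists of its neighbours
in `H`, and new messages other than along edges of `H` carry references that were in its memory or
among the delivered messages, and travel along strictly shorter edges. -/
lemma buildMST_of_locallyMinimal (h4 : FourPoint V) (hd : DistinctDistances V)
    {H : SimpleGraph V} (hH : LocallyMinimal H) {v : V} {D : Multiset V} {c c' : Config V}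
    (h : buildMST V v D c c')
    (hc : ∀ u, (u ∈ c.nbrs v ∨ u ∈ c.chan v) → H.Reachable v u)
    (hHN : ∀ u, H.Adj v u → u ∈ c.nbrs v) :
    (∀ u, u ∈ c'.nbrs v ↔ H.Adj v u) ∧
      ∀ a b, ¬ H.Adj a b →
        (c'.chan a).count b ≤ (Function.update c.chan v (c.chan v - D) a).count b ∨
        ((b ∈ c.nbrs v ∨ b ∈ D) ∧ ¬ H.Adj v b ∧ dist a b < dist v b) := by
  obtain ⟨hD, l, N', hl, hloop, hN'⟩ := h
  obtain rfl : N' = c'.nbrs v := by simp [hN']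
  have hN : ∀ u ∈ c.nbrs v ∪ D.toFinset, v ≠ u ∧ H.Reachable v u := by
    intro u hu
    have hu' : u ∈ c.nbrs v ∨ u ∈ c.chan v := by
      rw [Finset.mem_union, Multiset.mem_toFinset] at hu
      exact hu.imp_right fun h => Multiset.mem_of_le hD h
    refine ⟨?_, hc u hu'⟩
    rintro rfl
    exact hu'.elim (c.self_notMem_nbrs v) (c.self_notMem_chan v)
  have hmem : ∀ u, u ∈ l ↔ u ∈ c.nbrs v ∪ D.toFinset := fun u => by
    rw [← Multiset.mem_coe, hl]; rfl
  obtain ⟨h1, h2, h3⟩ := hloop.of_locallyMinimal h4 hd hH hN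
    (fun u hu => hN u ((hmem u).1 hu)) (fun u hu => Finset.mem_union_left _ (hHN u hu))
  refine ⟨fun u => ⟨fun hu => (h2 u hu).2 ((hmem u).2 (h2 u hu).1), h1 u⟩, fun a b hab => ?_⟩
  refine (h3 a b hab).imp_right fun h => ⟨?_, h.2⟩
  simpa using (hmem b).1 h.1

end Steps

/-! ### Legality from a locally minimal graph -/

section Stabilization

variable {V : Type*} [MetricSpace V]

/-- A configuration whose explicit edges are the edges of a locally minimal graph, in both
directions, and whose implicit edges are among them, is legal. -/
lemma mem_legalMST_of_locallyMinimal [Finite V] (h4 : FourPoint V) (hd : DistinctDistances V)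
    {H : SimpleGraph V} (hH : LocallyMinimal H) {c : Config V}
    (hn : ∀ v w, w ∈ c.nbrs v ↔ H.Adj v w) (hc : ∀ v w, w ∈ c.chan v → H.Adj v w) :
    c ∈ legalMST V := by
  have hG : c.graph = H := by
    ext v w
    rw [Config.graph_adj]
    refine ⟨fun h => ?_, fun h => ⟨h.ne, .inl (.inl ((hn v w).2 h))⟩⟩
    rcases h.2 with (h | h) | (h | h)
    · exact (hn v w).1 h
    · exact hc v w h
    · exact ((hn w v).1 h).symm
    · exact (hc w v h).symm
  rw [mem_legalMST_iff h4 hd, hG]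
  exact ⟨fun v w => (hn v w).trans (hH.adj_iff h4 hd),
    fun v w h => (hH.adj_iff h4 hd).1 (hc v w h)⟩

/-! ### Closure -/

lemma legalMST_closed [Finite V] [DecidableEq V] (h4 : FourPoint V) (hd : DistinctDistances V)
    {c c' : Config V} (hc : c ∈ legalMST V) (h : (buildMST V).Succ c c') : c' ∈ legalMST V := by
  obtain ⟨v, D, h⟩ := h
  obtain ⟨hn, hi⟩ := (mem_legalMST_iff h4 hd).1 hc
  have hadj : ∀ a b, c.graph.Adj a b ↔ IsRNGEdge c.graph a b := by
    intro a b
    refine ⟨fun hab => ?_, fun hab => ⟨hab.1, .inl (.inl ((hn a b).2 hab))⟩⟩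
    rcases (Config.graph_adj.1 hab).2 with (h | h) | (h | h)
    · exact (hn a b).1 h
    · exact hi a b h
    · exact ((hn b a).1 h).symm
    · exact (hi b a h).symm
  have hH : LocallyMinimal c.graph := fun x y u hxy hxu =>
    ((hadj x y).1 hxy).2.2 u hxu.reachable
  have hedge : ∀ a b, (b ∈ c.nbrs a ∨ b ∈ c.chan a) → c.graph.Adj a b := fun a b hb =>
    (hadj a b).2 (hb.elim (hn a b).1 (hi a b))
  obtain ⟨h1, h2⟩ := buildMST_of_locallyMinimal h4 hd hH h
    (fun u hu => (hedge v u hu).reachable) (fun u hu => (hn v u).2 ((hadj v u).1 hu))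
  refine mem_legalMST_of_locallyMinimal h4 hd hH (fun a b => ?_) (fun a b hb => ?_)
  · by_cases ha : a = v
    · exact ha ▸ h1 b
    · rw [buildMST_nbrs_of_ne h ha, hn, hadj]
  · by_contra hab
    rcases h2 a b hab with h3 | ⟨h3, h4, -⟩
    · have hle : Function.update c.chan v (c.chan v - D) a ≤ c.chan a := by
        by_cases ha : a = v
        · subst ha; simp
        · simp [ha]
      have : 0 < (c.chan a).count b :=
        (Multiset.count_pos.2 hb).trans_le (h3.trans (Multiset.count_le_of_le b hle))
      exact hab (hedge a b (.inr (Multiset.count_pos.1 this)))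
    · exact h4 (hedge v b (h3.imp_right fun hD => Multiset.mem_of_le h.1 hD))

/-! ### Critical edges -/

lemma wellFounded_dist_lt [Finite V] :
    WellFounded fun p q : V × V => dist p.1 p.2 < dist q.1 q.2 :=
  have : IsTrans (V × V) fun p q => dist p.1 p.2 < dist q.1 q.2 := ⟨fun _ _ _ => lt_trans⟩
  have : Std.Irrefl fun p q : V × V => dist p.1 p.2 < dist q.1 q.2 := ⟨fun _ => lt_irrefl _⟩
  Finite.wellFounded_of_trans_of_irrefl _

lemma wellFounded_dist_gt [Finite V] :
    WellFounded fun p q : V × V => dist q.1 q.2 < dist p.1 p.2 :=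
  have : IsTrans (V × V) fun p q => dist q.1 q.2 < dist p.1 p.2 :=
    ⟨fun _ _ _ h1 h2 => lt_trans h2 h1⟩
  have : Std.Irrefl fun p q : V × V => dist q.1 q.2 < dist p.1 p.2 := ⟨fun _ => lt_irrefl _⟩
  Finite.wellFounded_of_trans_of_irrefl _

/-- The edges of `c` whose ends are not connected by shorter edges of `c`. If different pairs of
nodes have different distances, they form the minimum spanning forest of the graph of `c`. -/
def criticalGraph (c : Config V) : SimpleGraph V where
  Adj a b := c.graph.Adj a b ∧ ¬ ConnBelow c (dist a b) a b
  symm := ⟨fun a b h => ⟨h.1.symm, fun h' => h.2 (dist_comm a b ▸ SimpleGraph.Reachable.symm h')⟩⟩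
  loopless := ⟨fun _ h => h.1.ne rfl⟩

lemma criticalGraph_reachable [Finite V] {c : Config V} {a b : V} (hab : c.graph.Reachable a b) :
    (criticalGraph c).Reachable a b := by
  have key : ∀ p : V × V, c.graph.Adj p.1 p.2 → (criticalGraph c).Reachable p.1 p.2 := by
    intro p
    refine wellFounded_dist_lt.induction (C := fun p : V × V => c.graph.Adj p.1 p.2 →
      (criticalGraph c).Reachable p.1 p.2) p fun p ih hp => ?_
    by_cases hb : ConnBelow c (dist p.1 p.2) p.1 p.2
    · refine SimpleGraph.Reachable.of_forall_adj hb fun x y hxy => ?_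
      rw [SimpleGraph.fromRel_adj] at hxy
      refine ih (x, y) ?_ ⟨hxy.1, hxy.2.imp And.left And.left⟩
      exact hxy.2.elim And.right fun h => dist_comm x y ▸ h.2
    · exact SimpleGraph.Adj.reachable ⟨hp, hb⟩
  exact hab.of_forall_adj fun x y hxy => key (x, y) hxy

/-! ### Convergence -/

lemma exists_forall_ge_eq_of_monotone {α : Type*} [Finite α] {f : ℕ → Set α} (hf : Monotone f) :
    ∃ n, ∀ m ≥ n, f m = f n := by
  obtain ⟨n, hn⟩ := WellFoundedGT.monotone_chain_condition ⟨f, hf⟩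
  exact ⟨n, fun m hm => (hn m hm).symm⟩

variable [DecidableEq V] {c : ℕ → Config V} {act : ℕ → V} {dlv : ℕ → Multiset V}

/-- Bottleneck distances and components are eventually constant. -/
lemma exists_connBelow_stable [Finite V] (h : (buildMST V).IsComputation c act dlv) :
    ∃ t₀, ∀ t ≥ t₀,
      (∀ a b x y : V, ConnBelow (c t) (dist x y) a b → ConnBelow (c t₀) (dist x y) a b) ∧
      ∀ a b, (c t).graph.Reachable a b → (c t₀).graph.Reachable a b := by
  obtain ⟨m, hm⟩ := exists_forall_ge_eq_of_monotone
    (f := fun t => {p : (V × V) × V × V | ConnBelow (c t) (dist p.2.1 p.2.2) p.1.1 p.1.2})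
    (monotone_nat_of_le_succ fun t _ hp => ConnBelow.step (h.step t) hp)
  obtain ⟨n, hn⟩ := exists_forall_ge_eq_of_monotone
    (f := fun t => {p : V × V | (c t).graph.Reachable p.1 p.2})
    (monotone_nat_of_le_succ fun t _ hp => buildMST_reachable (h.step t) hp)
  refine ⟨max m n, fun t ht => ⟨fun a b x y hab => ?_, fun a b hab => ?_⟩⟩
  · have h1 := (hm t (le_trans (le_max_left _ _) ht)).trans (hm (max m n) (le_max_left _ _)).symm
    exact (Set.ext_iff.1 h1 ((a, b), x, y)).1 hab
  · have h1 := (hn t (le_trans (le_max_right _ _) ht)).trans (hn (max m n) (le_max_right _ _)).symm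
    exact (Set.ext_iff.1 h1 (a, b)).1 hab

/-- Critical edges are never delegated once bottleneck distances are constant, so their messages
are delivered into memory for good and their introductions create the reverse edges. -/
lemma eventually_mem_nbrs_of_critical [Finite V] (h : (buildMST V).IsComputation c act dlv) {t₀ : ℕ}
    (h₀ : ∀ t ≥ t₀, ∀ a b x y : V,
      ConnBelow (c t) (dist x y) a b → ConnBelow (c t₀) (dist x y) a b) :
    ∀ᶠ t in Filter.atTop, ∀ a b, (criticalGraph (c t₀)).Adj a b → b ∈ (c t).nbrs a := by
  have hnot : ∀ {a b}, (criticalGraph (c t₀)).Adj a b → ∀ t ≥ t₀,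
      ¬ ConnBelow (c t) (dist a b) a b := fun hab t ht hcb => hab.2 (h₀ t ht _ _ _ _ hcb)
  have hstay : ∀ {a b}, (criticalGraph (c t₀)).Adj a b → ∀ t ≥ t₀, b ∈ (c t).nbrs a →
      ∀ t' ≥ t, b ∈ (c t').nbrs a := by
    intro a b hab t ht hb t' ht'
    induction t', ht' using Nat.le_induction with
    | base => exact hb
    | succ s hs ih =>
      exact (buildMST_mem_nbrs_or_connBelow (h.step s) ih).resolve_right
        (hnot hab _ (by omega))
  have hedge : ∀ {a b}, (criticalGraph (c t₀)).Adj a b → ∀ t ≥ t₀,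
      (b ∈ (c t).nbrs a ∨ b ∈ (c t).chan a) → ∃ t' ≥ t₀, b ∈ (c t').nbrs a := by
    rintro a b hab t ht (hb | hb)
    · exact ⟨t, ht, hb⟩
    · obtain ⟨s, hs, rfl, hD⟩ := h.fairReceipt a b t hb
      exact ⟨s + 1, by omega, ((buildMST_mem_or_connBelow (h.step s) (.inr hD)).resolve_right
        (hnot hab _ (by omega))).1⟩
  have hrev : ∀ {a b}, (criticalGraph (c t₀)).Adj a b → (∃ t ≥ t₀, b ∈ (c t).nbrs a) →
      ∃ t ≥ t₀, a ∈ (c t).nbrs b := by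
    rintro a b hab ⟨t, ht, hb⟩
    obtain ⟨s, hs, rfl⟩ := h.weaklyFair a t
    have hb' := hstay hab t ht hb s hs
    exact hedge hab.symm (s + 1) (by omega)
      (.inr ((buildMST_mem_or_connBelow (h.step s) (.inl hb')).resolve_right
        (hnot hab _ (by omega))).2)
  refine Filter.eventually_all.2 fun a => Filter.eventually_all.2 fun b => ?_
  by_cases hab : (criticalGraph (c t₀)).Adj a b
  · have : ∃ t ≥ t₀, b ∈ (c t).nbrs a := by
      rcases (Config.graph_adj.1 hab.1).2 with h1 | h1
      · exact hedge hab t₀ le_rfl h1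
      · exact hrev hab.symm (hedge hab.symm t₀ le_rfl h1)
    obtain ⟨t, ht, hb⟩ := this
    exact Filter.eventually_atTop.2 ⟨t, fun t' ht' _ => hstay hab t ht hb t' ht'⟩
  · exact .of_forall fun _ h' => absurd h' hab

/-- The critical graph is locally minimal: otherwise some node would delegate a critical edge. -/
lemma criticalGraph_locallyMinimal (h : (buildMST V).IsComputation c act dlv) {t₀ t₁ : ℕ}
    (h₁ : ∀ t ≥ t₁, ∀ a b, (criticalGraph (c t₀)).Adj a b → b ∈ (c t).nbrs a) :
    LocallyMinimal (criticalGraph (c t₀)) := by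
  intro x y u hxy hxu
  obtain ⟨s, hs, rfl⟩ := h.weaklyFair x t₁
  exact buildMST_not_closer (h.step s) (h₁ _ (by omega) _ _ hxy) (h₁ _ (by omega) _ _ hxu)

lemma eventually_nbrs_iff [Finite V] (h4 : FourPoint V) (hd : DistinctDistances V)
    (h : (buildMST V).IsComputation c act dlv) {H : SimpleGraph V} (hH : LocallyMinimal H) {t₁ : ℕ}
    (h₁ : ∀ t ≥ t₁, ∀ a b, H.Adj a b → b ∈ (c t).nbrs a)
    (hr : ∀ t ≥ t₁, ∀ a b, (b ∈ (c t).nbrs a ∨ b ∈ (c t).chan a) → H.Reachable a b) :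
    ∀ᶠ t in Filter.atTop, ∀ a b, b ∈ (c t).nbrs a ↔ H.Adj a b := by
  refine Filter.eventually_all.2 fun a => ?_
  have hstep : ∀ s ≥ t₁, act s = a → ∀ b, b ∈ (c (s + 1)).nbrs a ↔ H.Adj a b := by
    rintro s hs rfl
    exact (buildMST_of_locallyMinimal h4 hd hH (h.step s) (hr s hs _) (h₁ s hs _)).1
  obtain ⟨s, hs, ha⟩ := h.weaklyFair a t₁
  refine Filter.eventually_atTop.2 ⟨s + 1, fun t ht => ?_⟩
  induction t, ht using Nat.le_induction with
  | base => exact hstep s hs ha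
  | succ t ht ih =>
    by_cases hat : act t = a
    · exact hstep t (by omega) hat
    · rwa [buildMST_nbrs_of_ne (h.step t) (Ne.symm hat)]

/-- Messages along edges outside `H` die out, the longest ones first: when no message along a
longer such edge exists any more, no new message along an edge of the present length is created,
and the finitely many copies that are left are delivered one after the other. -/
lemma eventually_chan_imp [Finite V] (h4 : FourPoint V) (hd : DistinctDistances V)
    (h : (buildMST V).IsComputation c act dlv) {H : SimpleGraph V} (hH : LocallyMinimal H) {t₁ : ℕ}
    (h₁ : ∀ t ≥ t₁, ∀ a b, b ∈ (c t).nbrs a ↔ H.Adj a b)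
    (hr : ∀ t ≥ t₁, ∀ a b, (b ∈ (c t).nbrs a ∨ b ∈ (c t).chan a) → H.Reachable a b) :
    ∀ᶠ t in Filter.atTop, ∀ a b, b ∈ (c t).chan a → H.Adj a b := by
  suffices key : ∀ p : V × V, ∀ᶠ t in Filter.atTop, p.2 ∈ (c t).chan p.1 → H.Adj p.1 p.2 from
    Filter.eventually_all.2 fun a => Filter.eventually_all.2 fun b => key (a, b)
  intro p
  refine wellFounded_dist_gt.induction (C := fun p : V × V => ∀ᶠ t in Filter.atTop,
    p.2 ∈ (c t).chan p.1 → H.Adj p.1 p.2) p ?_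
  rintro ⟨a, b⟩ ih
  by_cases hab : H.Adj a b
  · exact .of_forall fun _ _ => hab
  have hlong : ∀ᶠ t in Filter.atTop, ∀ q : V × V, dist a b < dist q.1 q.2 →
      q.2 ∈ (c t).chan q.1 → H.Adj q.1 q.2 :=
    Filter.eventually_all.2 fun q => Filter.eventually_imp_distrib_left.2 (ih q)
  obtain ⟨T', hT'⟩ := Filter.eventually_atTop.1 hlong
  obtain ⟨T, hT1, hT⟩ : ∃ T ≥ t₁, ∀ t ≥ T, ∀ q : V × V, dist a b < dist q.1 q.2 →
      q.2 ∈ (c t).chan q.1 → H.Adj q.1 q.2 :=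
    ⟨max t₁ T', le_max_left _ _, fun t ht => hT' t (le_trans (le_max_right _ _) ht)⟩
  have hcount : ∀ t ≥ T, ((c (t + 1)).chan a).count b ≤
      (Function.update (c t).chan (act t) ((c t).chan (act t) - dlv t) a).count b := by
    intro t ht
    have htt : t ≥ t₁ := le_trans hT1 ht
    refine ((buildMST_of_locallyMinimal h4 hd hH (h.step t) (hr t htt _)
      (fun u hu => (h₁ t htt _ u).2 hu)).2 a b hab).resolve_right ?_
    rintro ⟨h2 | h2, h3, h5⟩
    · exact h3 ((h₁ t htt _ _).1 h2)
    · exact h3 (hT t ht (act t, b) h5 (Multiset.mem_of_le (h.step t).1 h2))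
  have hle : ∀ t ≥ T, ((c (t + 1)).chan a).count b ≤ ((c t).chan a).count b := by
    intro t ht
    refine (hcount t ht).trans (Multiset.count_le_of_le b ?_)
    by_cases ha : a = act t
    · rw [ha, Function.update_self]
      exact tsub_le_self
    · rw [Function.update_of_ne ha]
  have hle' : ∀ t ≥ T, ∀ t' ≥ t, ((c t').chan a).count b ≤ ((c t).chan a).count b := by
    intro t ht t' ht'
    induction t', ht' using Nat.le_induction with
    | base => exact le_rfl
    | succ s hs ihs => exact (hle s (le_trans ht hs)).trans ihs
  have hzero : ∀ n t, t ≥ T → ((c t).chan a).count b = n →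
      ∃ t' ≥ T, ((c t').chan a).count b = 0 := by
    intro n
    induction n using Nat.strong_induction_on with
    | _ n ihn =>
      intro t ht hn
      by_cases h0 : n = 0
      · exact ⟨t, ht, hn.trans h0⟩
      · obtain ⟨s, hs, rfl, hD⟩ := h.fairReceipt a b t
          (Multiset.count_pos.1 (hn ▸ Nat.pos_of_ne_zero h0))
        have h2 := hcount s (le_trans ht hs)
        rw [Function.update_self, Multiset.count_sub] at h2
        have h3 := Multiset.count_pos.2 hD
        have h5 := hle' t ht s hs
        exact ihn _ (by omega) (s + 1) (by omega) rfl
  obtain ⟨t, ht, h0⟩ := hzero _ T le_rfl rfl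
  refine Filter.eventually_atTop.2 ⟨t, fun t' ht' hb => ?_⟩
  have h2 := hle' t ht t' ht'
  have h3 := Multiset.count_pos.2 hb
  dsimp only at h3
  omega

lemma exists_mem_legalMST [Finite V] (h4 : FourPoint V) (hd : DistinctDistances V)
    (h : (buildMST V).IsComputation c act dlv) : ∃ t, c t ∈ legalMST V := by
  obtain ⟨t₀, h₀⟩ := exists_connBelow_stable h
  obtain ⟨t₁, h₁⟩ := Filter.eventually_atTop.1
    (eventually_mem_nbrs_of_critical h fun t ht => (h₀ t ht).1)
  have hH := criticalGraph_locallyMinimal h h₁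
  have hr : ∀ t ≥ max t₀ t₁, ∀ a b, (b ∈ (c t).nbrs a ∨ b ∈ (c t).chan a) →
      (criticalGraph (c t₀)).Reachable a b := fun t ht a b hb =>
    criticalGraph_reachable ((h₀ t (le_trans (le_max_left _ _) ht)).2 a b
      (connBelow_of_mem hb (lt_add_one _)).reachable)
  obtain ⟨t₂, h₂⟩ := Filter.eventually_atTop.1 (eventually_nbrs_iff h4 hd h hH
    (fun t ht => h₁ t (le_trans (le_max_right _ _) ht)) hr)
  obtain ⟨t₃, h₃⟩ := Filter.eventually_atTop.1 (eventually_chan_imp h4 hd h hH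
    (t₁ := max (max t₀ t₁) t₂) (fun t ht => h₂ t (le_trans (le_max_right _ _) ht))
    (fun t ht => hr t (le_trans (le_max_left _ _) ht)))
  exact ⟨max t₂ t₃, mem_legalMST_of_locallyMinimal h4 hd hH (h₂ _ (le_max_left _ _))
    (h₃ _ (le_max_right _ _))⟩

end Stabilization

theorem mainTheorem1 {V : Type*} [Fintype V] [DecidableEq V] [MetricSpace V]
    {VT : Type*} (T : SimpleGraph VT) (f : Sym2 VT → ℝ) (ι : V ↪ VT)
    (hV : IsTreeMetric T f ι) (hd : DistinctDistances V) :
    (buildMST V).IsSelfStabilizing (legalMST V) :=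
  ⟨fun _ _ _ _ h _ => exists_mem_legalMST hV.fourPoint hd h,
    fun _ hc _ h => legalMST_closed hV.fourPoint hd hc h⟩
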